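/- Let $\mathbb{D}$ be the open unit disk in $\mathbb{C}$, let $g$ be a continuous complex-valued function on $\overline{\mathbb{D}}$, put $\|g\|_\infty=\sup_{z\in\overline{\mathbb{D}}}|g(z)|$, and let $f\in\mathcal{C}(\overline{\mathbb{D}})\cap\mathcal{C}^2(\mathbb{D})$ satisfy $\Delta f=g$ in $\mathbb{D}$. Suppose that $f$ is $K$-quasiconformal in $\mathbb{D}$ for some $K\ge 1$, i.e. a sense-preserving homeomorphism of $\mathbb{D}$ onto a domain with $\|D_f\|^2\le K|\det D_f|$ in $\mathbb{D}$, where $\|D_f\|$ is the operator norm of the real derivative. Suppose also that $$M:=\sup_{\theta\in[0,2\pi]}\ \sup_{0\le r<1}\int_0^r\left|f_z(\rho e^{i\theta})+e^{-2i\theta}f_{\overline z}(\rho e^{i\theta})\right|d\rho<\infty .$$ For $z\in\mathbb{D}$ let $$P[f](z)=\frac1{2\pi}\int_0^{2\pi}\frac{1-|z|^2}{|1-ze^{-it}|^2}f(e^{it})\,dt$$ be the Poisson integral of the boundary values of $f$. Then $P[f]$ has an expansion $$P[f](z)=\sum_{n=0}^\infty a_nz^n+\sum_{n=1}^\infty\overline{b}_n\overline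 z^n\qquad(z\in\mathbb{D}),$$ and its coefficients satisfy $$|a_n|+|b_n|\le KM+\tfrac23\|g\|_\infty\qquad\text{for all } n\ge1 .$$ When $K=1$ and $g=0$ the estimate is sharp: for every $M>0$ the function $f(z)=Mz$ satisfies all the hypotheses with $K=1$, $g=0$ and this value of $M$, and equality holds for $n=1$. -/

import Mathlib

open scoped ENNReal NNReal

namespace PoissonQC

/-- The class `F_g(𝔻)` on the open unit disk: complex-valued functions that are continuous on the
closed unit disk, of class `C²` on the open unit disk, and satisfy Poisson's equation `Δ f = g`
in the open unit disk. -/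
structure IsPoissonSolution (g f : ℂ → ℂ) : Prop where
  continuousOn : ContinuousOn f (Metric.closedBall 0 1)
  contDiffOn : ContDiffOn ℝ 2 f (Metric.ball 0 1)
  laplacian_eq : ∀ z ∈ Metric.ball (0 : ℂ) 1, (Laplacian.laplacian f : ℂ → ℂ) z = g z

/-- `K`-quasiconformal mappings of class `C¹` on an open set `Ω`: sense-preserving homeomorphisms of
`Ω` onto an open set with `‖D_f‖² ≤ K |det D_f|`, where `‖D_f‖` is the operator norm
of the real derivative. Maps of class `C¹` lie in `W^{1,2}_loc(Ω)`. For a homeomorphism of class `C¹`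
being sense-preserving means that its Jacobian is nowhere negative (the Jacobian cannot vanish
identically, because the image is open). -/
structure IsQuasiconformalOn (K : ℝ) (f : ℂ → ℂ) (Ω : Set ℂ) : Prop where
  one_le : 1 ≤ K
  contDiffOn : ContDiffOn ℝ 1 f Ω
  isOpenEmbedding : Topology.IsOpenEmbedding (Ω.domRestrict f)
  sensePreserving : ∀ z ∈ Ω, 0 ≤ (fderiv ℝ f z).det
  distortion : ∀ z ∈ Ω, ‖fderiv ℝ f z‖ ^ 2 ≤ K * |(fderiv ℝ f z).det|

/-- The formal derivative `f_z = (f_x - i f_y) / 2`. -/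
noncomputable def dz (f : ℂ → ℂ) (z : ℂ) : ℂ :=
  (fderiv ℝ f z 1 - Complex.I * fderiv ℝ f z Complex.I) / 2

/-- The formal derivative `f_{z̄} = (f_x + i f_y) / 2`. -/
noncomputable def dzbar (f : ℂ → ℂ) (z : ℂ) : ℂ :=
  (fderiv ℝ f z 1 + Complex.I * fderiv ℝ f z Complex.I) / 2

/-- The radial length `ℓ*_f(r, θ) = ∫₀ʳ |f_z(ρ e^{iθ}) + e^{-2iθ} f_{z̄}(ρ e^{iθ})| dρ`. -/
noncomputable def radialLength (f : ℂ → ℂ) (r θ : ℝ) : ℝ :=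
  ∫ ρ in (0 : ℝ)..r,
    ‖dz f (ρ * Complex.exp (θ * Complex.I)) +
      Complex.exp (-2 * θ * Complex.I) * dzbar f (ρ * Complex.exp (θ * Complex.I))‖

/-- The total radial length `ℓ*_f(1, θ) = sup_{0 ≤ r < 1} ℓ*_f(r, θ)`, possibly infinite. -/
noncomputable def radialLengthOne (f : ℂ → ℂ) (θ : ℝ) : ℝ≥0∞ :=
  ⨆ r ∈ Set.Ico (0 : ℝ) 1, ENNReal.ofReal (radialLength f r θ)

/-- `sup_{θ ∈ [0, 2π]} ℓ*_f(1, θ)`, possibly infinite. -/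
noncomputable def supRadialLength (f : ℂ → ℂ) : ℝ≥0∞ :=
  ⨆ θ ∈ Set.Icc (0 : ℝ) (2 * Real.pi), radialLengthOne f θ

/-- The Poisson integral `P[ψ](z) = (1 / 2π) ∫₀^{2π} P(z, e^{it}) ψ(e^{it}) dt`, where
`P(z, e^{it}) = (1 - |z|²) / |e^{it} - z|² = (1 - |z|²) / |1 - z e^{-it}|²`. -/
noncomputable def poissonIntegral (ψ : ℂ → ℂ) (z : ℂ) : ℂ :=
  (1 / (2 * Real.pi) : ℝ) *
    ∫ t in (0 : ℝ)..(2 * Real.pi),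
      (poissonKernel 0 z (Complex.exp (t * Complex.I)) : ℂ) * ψ (Complex.exp (t * Complex.I))

/-- `h(z) = ∑_{n ≥ 0} a_n z^n + ∑_{n ≥ 1} conj(b_n) conj(z)^n` on the open unit disk, both series
being convergent. The value `b 0` is not used. -/
def HasHarmonicExpansion (h : ℂ → ℂ) (a b : ℕ → ℂ) : Prop :=
  ∀ z ∈ Metric.ball (0 : ℂ) 1, ∃ s t : ℂ,
    HasSum (fun n : ℕ => a n * z ^ n) s ∧
    HasSum (fun n : ℕ => starRingEnd ℂ (b (n + 1)) * starRingEnd ℂ z ^ (n + 1)) t ∧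
    h z = s + t

/-- `‖g‖_∞`, the supremum of `|g|` over the closed unit disk. -/
noncomputable def supNorm (g : ℂ → ℂ) : ℝ :=
  sSup ((fun z => ‖g z‖) '' Metric.closedBall (0 : ℂ) 1)

end PoissonQC

namespace PoissonQC

open MeasureTheory Set Complex

/-! The coefficients of `P[f]` are the Fourier coefficients of `f` on the unit circle, so no Green
potential is needed: it suffices to follow the Fourier coefficients of `f` on circles of radius `s`
from `s = 0` to `s = 1`.

Let `A`, `P`, `G` be the coefficients of `f`, `f_z`, `g` of index `n`, `n - 1`, `n`. Polar
coordinates and `4 ∂_z̄ ∂_z f = g` give `A' = -(n/s) A + 2P` and `P' = ((n-1)/s) P + G/2`. With the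
weight `w = (s/R)^n` this integrates to `A(R) = ∫₀ᴿ P + ∫₀ᴿ (1-w) s G / (2n)`
(`norm_le_of_radial_system`). The index `-n`, with `f_z̄` in place of `f_z`, leads to the same
system.

Adding both indices, the two `P`-integrals are at most `∬ (|f_z| + |f_z̄|) dt ds`. Quasiconformality
bounds the integrand by `K |f_z + e^{-2it} f_z̄|`, and Fubini turns the double integral into an
average of radial lengths, at most `2πKM`. The two `G`-terms contribute at most `π‖g‖_∞`. Letting `R
→ 1` and dividing by `2π` gives `KM + ‖g‖_∞ / 2`, which is stronger than the stated bound. -/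

/-! ### Wirtinger derivatives and the Laplacian. -/

lemma fderiv_apply_eq_dz_add_dzbar (f : ℂ → ℂ) (z v : ℂ) :
    fderiv ℝ f z v = dz f z * v + dzbar f z * starRingEnd ℂ v := by
  have hv : v = v.re • (1 : ℂ) + v.im • I := by
    apply Complex.ext <;> simp
  have h1 : fderiv ℝ f z v = (v.re : ℂ) * fderiv ℝ f z 1 + (v.im : ℂ) * fderiv ℝ f z I := by
    conv_lhs => rw [hv]
    rw [map_add, map_smul, map_smul, Complex.real_smul, Complex.real_smul]
  have h2 : v = v.re + v.im * I := (re_add_im v).symm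
  have h3 : starRingEnd ℂ v = v.re - v.im * I := by
    apply Complex.ext <;> simp
  rw [h1, h3]
  conv_rhs => enter [1, 2]; rw [h2]
  unfold dz dzbar
  linear_combination ((v.im : ℂ) * fderiv ℝ f z I) * I_sq

lemma contDiffOn_dz {f : ℂ → ℂ} {U : Set ℂ} (hU : IsOpen U) {m : ℕ}
    (hf : ContDiffOn ℝ (m + 1) f U) : ContDiffOn ℝ m (dz f) U := by
  have h := hf.fderiv_of_isOpen hU (m := m) le_rfl
  unfold dz
  exact ((h.clm_apply contDiffOn_const).sub
    (contDiffOn_const.mul (h.clm_apply contDiffOn_const))).div_const 2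

lemma contDiffOn_dzbar {f : ℂ → ℂ} {U : Set ℂ} (hU : IsOpen U) {m : ℕ}
    (hf : ContDiffOn ℝ (m + 1) f U) : ContDiffOn ℝ m (dzbar f) U := by
  have h := hf.fderiv_of_isOpen hU (m := m) le_rfl
  unfold dzbar
  exact ((h.clm_apply contDiffOn_const).add
    (contDiffOn_const.mul (h.clm_apply contDiffOn_const))).div_const 2

lemma laplacian_eq_fderiv_fderiv (f : ℂ → ℂ) (z : ℂ) :
    (Laplacian.laplacian f : ℂ → ℂ) z =
      fderiv ℝ (fderiv ℝ f) z 1 1 + fderiv ℝ (fderiv ℝ f) z I I := by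
  rw [InnerProductSpace.laplacian_eq_iteratedFDeriv_complexPlane]
  simp [iteratedFDeriv_two_apply]

/-- The mixed partial derivatives cancel because the second derivative of a `C²` map is symmetric.
-/
lemma dzbar_dz_and_dz_dzbar {f : ℂ → ℂ} {U : Set ℂ} (hU : IsOpen U) (hf : ContDiffOn ℝ 2 f U)
    {z : ℂ} (hz : z ∈ U) :
    dzbar (dz f) z = (Laplacian.laplacian f : ℂ → ℂ) z / 4 ∧
      dz (dzbar f) z = (Laplacian.laplacian f : ℂ → ℂ) z / 4 := by
  have hfz : ContDiffAt ℝ 2 f z := hf.contDiffAt (hU.mem_nhds hz)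
  have hd : DifferentiableAt ℝ (fderiv ℝ f) z :=
    (hfz.fderiv_right (m := 1) (by norm_num)).differentiableAt (by norm_num)
  have hsymm : fderiv ℝ (fderiv ℝ f) z 1 I = fderiv ℝ (fderiv ℝ f) z I 1 :=
    (hfz.isSymmSndFDerivAt (by simp)).eq 1 I
  have key : ∀ w : ℂ, HasFDerivAt (fun x => fderiv ℝ f x w)
      ((fderiv ℝ (fderiv ℝ f) z).flip w) z := fun w => by
    simpa using hd.hasFDerivAt.clm_apply (hasFDerivAt_const w z)
  have h1 : HasFDerivAt (dz f) ((2⁻¹ : ℂ) • ((fderiv ℝ (fderiv ℝ f) z).flip 1 -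
      I • (fderiv ℝ (fderiv ℝ f) z).flip I)) z := by
    have := ((key 1).sub ((key I).const_mul I)).const_mul (2⁻¹ : ℂ)
    refine this.congr_of_eventuallyEq (Filter.Eventually.of_forall fun x => ?_)
    simp only [dz, Pi.sub_apply]; ring
  have h2 : HasFDerivAt (dzbar f) ((2⁻¹ : ℂ) • ((fderiv ℝ (fderiv ℝ f) z).flip 1 +
      I • (fderiv ℝ (fderiv ℝ f) z).flip I)) z := by
    have := ((key 1).add ((key I).const_mul I)).const_mul (2⁻¹ : ℂ)
    refine this.congr_of_eventuallyEq (Filter.Eventually.of_forall fun x => ?_)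
    simp only [dzbar, Pi.add_apply]; ring
  rw [laplacian_eq_fderiv_fderiv]
  constructor
  · rw [dzbar, h1.fderiv]
    simp only [_root_.smul_apply, _root_.sub_apply,
      ContinuousLinearMap.flip_apply, smul_eq_mul, hsymm]
    linear_combination (-fderiv ℝ (fderiv ℝ f) z I I / 4) * I_sq
  · rw [dz, h2.fderiv]
    simp only [_root_.smul_apply, _root_.add_apply,
      ContinuousLinearMap.flip_apply, smul_eq_mul, hsymm]
    linear_combination (-fderiv ℝ (fderiv ℝ f) z I I / 4) * I_sq

/-! ### Fourier coefficients on circles. -/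

/-- The `k`-th Fourier coefficient, times `2π`, of `h` on the circle of radius `s`. -/
noncomputable def circleFourier (h : ℂ → ℂ) (k : ℤ) (s : ℝ) : ℂ :=
  ∫ t in (0 : ℝ)..(2 * Real.pi), h (s * exp (t * I)) * exp (-(k * t * I))

lemma norm_ofReal_mul_exp {s : ℝ} (hs : 0 ≤ s) (t : ℝ) : ‖(s : ℂ) * exp (t * I)‖ = s := by
  rw [norm_mul, norm_exp_ofReal_mul_I, mul_one, norm_real, Real.norm_of_nonneg hs]

lemma norm_exp_neg_int_mul (k : ℤ) (t : ℝ) : ‖exp (-(k * t * I))‖ = 1 := by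
  have : -((k : ℂ) * t * I) = ((-(k * t) : ℝ) : ℂ) * I := by push_cast; ring
  rw [this, norm_exp_ofReal_mul_I]

/-- Clamping the radius to `[0, R]` extends the polar form of `h` continuously to all of `ℝ × ℝ`, so
that results on parametric integrals of globally continuous integrands apply; `clamp_eq` removes the
clamp again. -/
lemma continuous_polar_clamp {E : Type*} [TopologicalSpace E] {h : ℂ → E} {R : ℝ} (hR : 0 ≤ R)
    (hh : ContinuousOn h (Metric.closedBall 0 R)) :
    Continuous fun p : ℝ × ℝ => h (((max 0 (min p.1 R) : ℝ) : ℂ) * exp (p.2 * I)) := by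
  refine hh.comp_continuous (by fun_prop) fun p => ?_
  rw [mem_closedBall_zero_iff, norm_ofReal_mul_exp (le_max_left _ _)]
  exact max_le hR (min_le_right _ _)

lemma clamp_eq {s R : ℝ} (hs : s ∈ Icc 0 R) : max 0 (min s R) = s := by
  rw [min_eq_left hs.2, max_eq_right hs.1]

lemma continuous_circle {E : Type*} [TopologicalSpace E] {h : ℂ → E} {R s : ℝ}
    (hs : s ∈ Icc 0 R) (hh : ContinuousOn h (Metric.closedBall 0 R)) :
    Continuous fun t : ℝ => h ((s : ℂ) * exp (t * I)) := by
  have := (continuous_polar_clamp (hs.1.trans hs.2) hh).comp (Continuous.prodMk_right s)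
  refine this.congr fun t => ?_
  simp only [Function.comp, clamp_eq hs]

lemma continuousOn_circleFourier {h : ℂ → ℂ} {R : ℝ} (hR : 0 ≤ R)
    (hh : ContinuousOn h (Metric.closedBall 0 R)) (k : ℤ) :
    ContinuousOn (circleFourier h k) (Icc 0 R) := by
  have hc : Continuous fun s : ℝ => ∫ t in (0 : ℝ)..(2 * Real.pi),
      h (((max 0 (min s R) : ℝ) : ℂ) * exp (t * I)) * exp (-(k * t * I)) := by
    apply intervalIntegral.continuous_parametric_intervalIntegral_of_continuous'
    exact (continuous_polar_clamp hR hh).mul (by fun_prop)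
  refine hc.continuousOn.congr fun s hs => ?_
  simp only [circleFourier, clamp_eq hs]

lemma norm_circleFourier_le {h : ℂ → ℂ} (k : ℤ) (s : ℝ) :
    ‖circleFourier h k s‖ ≤ ∫ t in (0 : ℝ)..(2 * Real.pi), ‖h (s * exp (t * I))‖ := by
  refine (intervalIntegral.norm_integral_le_integral_norm (by positivity)).trans_eq ?_
  simp only [norm_mul, norm_exp_neg_int_mul, mul_one]

/-- The factors `e^{±it}` in the radial and angular derivatives enter through this; they cause the
indices `k - 1` for `dz` and `k + 1` for `dzbar` below. -/
lemma circleFourier_shift (h : ℂ → ℂ) (k j : ℤ) (s : ℝ) :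
    ∫ t in (0 : ℝ)..(2 * Real.pi), exp (j * t * I) * h (s * exp (t * I)) * exp (-(k * t * I)) =
      circleFourier h (k - j) s := by
  unfold circleFourier
  congr 1 with t
  rw [mul_comm (exp _) (h _), mul_assoc, ← exp_add]
  congr 2
  push_cast; ring

/-! ### Differential equations for the Fourier coefficients in the radius. -/

lemma differentiableAt_of_mem_ball {h : ℂ → ℂ} (hh : ContDiffOn ℝ 1 h (Metric.ball 0 1)) {z : ℂ}
    (hz : ‖z‖ < 1) : DifferentiableAt ℝ h z :=
  (hh.contDiffAt (Metric.isOpen_ball.mem_nhds (by simpa using hz))).differentiableAt (by norm_num)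

lemma conj_exp_ofReal_mul_I (t : ℝ) : starRingEnd ℂ (exp (t * I)) = exp (-(t * I)) := by
  rw [← exp_conj]; simp

lemma hasDerivAt_radial {h : ℂ → ℂ} (hh : ContDiffOn ℝ 1 h (Metric.ball 0 1)) {s : ℝ}
    (hs : s ∈ Ioo (0 : ℝ) 1) (t : ℝ) :
    HasDerivAt (fun x : ℝ => h (x * exp (t * I)))
      (exp (t * I) * dz h (s * exp (t * I)) + exp (-(t * I)) * dzbar h (s * exp (t * I))) s := by
  have hd := (differentiableAt_of_mem_ball hh
    (by rw [norm_ofReal_mul_exp hs.1.le]; exact hs.2 : ‖(s : ℂ) * exp (t * I)‖ < 1)).hasFDerivAt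
  have hl : HasDerivAt (fun x : ℝ => (x : ℂ) * exp (t * I)) (exp (t * I)) s := by
    simpa using (ofRealCLM.hasDerivAt (x := s)).mul_const (exp (t * I))
  have := hd.comp_hasDerivAt s hl
  rw [fderiv_apply_eq_dz_add_dzbar, conj_exp_ofReal_mul_I] at this
  refine this.congr_deriv (by ring)

lemma hasDerivAt_angular {h : ℂ → ℂ} (hh : ContDiffOn ℝ 1 h (Metric.ball 0 1)) {s : ℝ}
    (hs : s ∈ Ioo (0 : ℝ) 1) (t : ℝ) :
    HasDerivAt (fun x : ℝ => h (s * exp (x * I)))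
      (I * s * (exp (t * I) * dz h (s * exp (t * I)) -
        exp (-(t * I)) * dzbar h (s * exp (t * I)))) t := by
  have hd := (differentiableAt_of_mem_ball hh
    (by rw [norm_ofReal_mul_exp hs.1.le]; exact hs.2 : ‖(s : ℂ) * exp (t * I)‖ < 1)).hasFDerivAt
  have hl : HasDerivAt (fun x : ℝ => (s : ℂ) * exp (x * I)) (s * (exp (t * I) * I)) t := by
    have h0 : HasDerivAt (fun x : ℝ => (x : ℂ) * I) I t := by
      simpa using (ofRealCLM.hasDerivAt (x := t)).mul_const I
    exact h0.cexp.const_mul _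
  have := hd.comp_hasDerivAt t hl
  rw [fderiv_apply_eq_dz_add_dzbar, map_mul, map_mul, conj_exp_ofReal_mul_I, conj_ofReal,
    conj_I] at this
  exact this.congr_deriv (by ring)

lemma continuousOn_dz_and_dzbar {h : ℂ → ℂ} (hh : ContDiffOn ℝ 1 h (Metric.ball 0 1)) :
    ContinuousOn (dz h) (Metric.ball 0 1) ∧ ContinuousOn (dzbar h) (Metric.ball 0 1) :=
  ⟨(contDiffOn_dz (m := 0) Metric.isOpen_ball (by simpa using hh)).continuousOn,
    (contDiffOn_dzbar (m := 0) Metric.isOpen_ball (by simpa using hh)).continuousOn⟩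

lemma continuous_circle_of_lt_one {h : ℂ → ℂ} (hh : ContinuousOn h (Metric.ball 0 1)) {s : ℝ}
    (hs : s ∈ Ico (0 : ℝ) 1) : Continuous fun t : ℝ => h ((s : ℂ) * exp (t * I)) :=
  continuous_circle (R := s) ⟨hs.1, le_rfl⟩
    (hh.mono (Metric.closedBall_subset_ball hs.2))

lemma integral_radial_deriv {h : ℂ → ℂ} (hh : ContDiffOn ℝ 1 h (Metric.ball 0 1)) (k : ℤ) {s : ℝ}
    (hs : s ∈ Ioo (0 : ℝ) 1) :
    ∫ t in (0 : ℝ)..(2 * Real.pi), (exp (t * I) * dz h (s * exp (t * I)) +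
        exp (-(t * I)) * dzbar h (s * exp (t * I))) * exp (-(k * t * I)) =
      circleFourier (dz h) (k - 1) s + circleFourier (dzbar h) (k + 1) s := by
  obtain ⟨h1, h2⟩ := continuousOn_dz_and_dzbar hh
  have c1 := continuous_circle_of_lt_one h1 ⟨hs.1.le, hs.2⟩
  have c2 := continuous_circle_of_lt_one h2 ⟨hs.1.le, hs.2⟩
  have e1 := circleFourier_shift (dz h) k 1 s
  have e2 := circleFourier_shift (dzbar h) k (-1) s
  rw [sub_neg_eq_add] at e2
  rw [← e1, ← e2, ← intervalIntegral.integral_add]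
  · congr 1 with t
    push_cast
    ring_nf
  · exact Continuous.intervalIntegrable (by fun_prop) _ _
  · exact Continuous.intervalIntegrable (by fun_prop) _ _

lemma integral_angular_deriv {h : ℂ → ℂ} (hh : ContDiffOn ℝ 1 h (Metric.ball 0 1)) (k : ℤ) {s : ℝ}
    (hs : s ∈ Ioo (0 : ℝ) 1) :
    ∫ t in (0 : ℝ)..(2 * Real.pi), (I * s * (exp (t * I) * dz h (s * exp (t * I)) -
        exp (-(t * I)) * dzbar h (s * exp (t * I)))) * exp (-(k * t * I)) =
      I * s * (circleFourier (dz h) (k - 1) s - circleFourier (dzbar h) (k + 1) s) := by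
  obtain ⟨h1, h2⟩ := continuousOn_dz_and_dzbar hh
  have c1 := continuous_circle_of_lt_one h1 ⟨hs.1.le, hs.2⟩
  have c2 := continuous_circle_of_lt_one h2 ⟨hs.1.le, hs.2⟩
  have e1 := circleFourier_shift (dz h) k 1 s
  have e2 := circleFourier_shift (dzbar h) k (-1) s
  rw [sub_neg_eq_add] at e2
  rw [← e1, ← e2, ← intervalIntegral.integral_sub, ← intervalIntegral.integral_const_mul]
  · congr 1 with t
    push_cast
    ring_nf
  · exact Continuous.intervalIntegrable (by fun_prop) _ _
  · exact Continuous.intervalIntegrable (by fun_prop) _ _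

lemma hasDerivAt_circleFourier {h : ℂ → ℂ} (hh : ContDiffOn ℝ 1 h (Metric.ball 0 1)) (k : ℤ)
    {s : ℝ} (hs : s ∈ Ioo (0 : ℝ) 1) :
    HasDerivAt (circleFourier h k)
      (circleFourier (dz h) (k - 1) s + circleFourier (dzbar h) (k + 1) s) s := by
  obtain ⟨h1, h2⟩ := continuousOn_dz_and_dzbar hh
  -- The derivatives may blow up at the unit circle; staying inside a radius `R < 1` gives the
  -- constant bound `B` that dominates the differentiated integrand.
  obtain ⟨R, hsR, hR1⟩ := exists_between hs.2
  have hR0 : 0 ≤ R := hs.1.le.trans hsR.le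
  have hsub := Metric.closedBall_subset_ball (x := (0 : ℂ)) hR1
  have c1 := continuous_polar_clamp hR0 (h1.mono hsub)
  have c2 := continuous_polar_clamp hR0 (h2.mono hsub)
  obtain ⟨B, hB⟩ := (isCompact_Icc.prod isCompact_Icc : IsCompact
    (Icc (0 : ℝ) R ×ˢ Icc (0 : ℝ) (2 * Real.pi))).exists_bound_of_continuousOn
    (f := fun p : ℝ × ℝ => (exp (p.2 * I) * dz h ((max 0 (min p.1 R) : ℝ) * exp (p.2 * I)) +
        exp (-(p.2 * I)) * dzbar h ((max 0 (min p.1 R) : ℝ) * exp (p.2 * I))) *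
        exp (-(k * p.2 * I))) (Continuous.continuousOn (by fun_prop))
  have hch : ∀ x ∈ Ico (0 : ℝ) 1, Continuous fun t : ℝ => h (x * exp (t * I)) := fun x hx =>
    continuous_circle_of_lt_one hh.continuousOn hx
  have c1' := continuous_circle_of_lt_one h1 ⟨hs.1.le, hs.2⟩
  have c2' := continuous_circle_of_lt_one h2 ⟨hs.1.le, hs.2⟩
  have hc := hch s ⟨hs.1.le, hs.2⟩
  have := (intervalIntegral.hasDerivAt_integral_of_dominated_loc_of_deriv_le
    (μ := volume) (a := 0) (b := 2 * Real.pi) (x₀ := s) (s := Ioo 0 R) (bound := fun _ => B)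
    (𝕜 := ℝ) (F := fun (x t : ℝ) => h (x * exp (t * I)) * exp (-(k * t * I)))
    (F' := fun (x t : ℝ) => (exp (t * I) * dz h (x * exp (t * I)) +
        exp (-(t * I)) * dzbar h (x * exp (t * I))) * exp (-(k * t * I)))
    (Ioo_mem_nhds hs.1 hsR) ?_ ?_ ?_ ?_ ?_ ?_).2
  · rw [integral_radial_deriv hh k hs] at this
    exact this
  · filter_upwards [Ioo_mem_nhds hs.1 hs.2] with x hx
    have := hch x ⟨hx.1.le, hx.2⟩
    exact Continuous.aestronglyMeasurable (this.mul (by fun_prop))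
  · exact Continuous.intervalIntegrable (hc.mul (by fun_prop)) _ _
  · exact Continuous.aestronglyMeasurable (by fun_prop)
  · refine Filter.Eventually.of_forall fun t ht x hx => ?_
    rw [uIoc_of_le Real.two_pi_pos.le] at ht
    have := hB (x, t) ⟨⟨hx.1.le, hx.2.le⟩, ⟨ht.1.le, ht.2⟩⟩
    simpa only [clamp_eq (⟨hx.1.le, hx.2.le⟩ : x ∈ Icc 0 R)] using this
  · exact intervalIntegrable_const
  · exact Filter.Eventually.of_forall fun t _ x hx =>
      (hasDerivAt_radial hh ⟨hx.1, hx.2.trans hR1⟩ t).mul_const _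

/-- Integration by parts in the angle; the boundary terms cancel by periodicity. -/
lemma mul_circleFourier_eq {h : ℂ → ℂ} (hh : ContDiffOn ℝ 1 h (Metric.ball 0 1)) (k : ℤ)
    {s : ℝ} (hs : s ∈ Ioo (0 : ℝ) 1) :
    k * circleFourier h k s =
      s * (circleFourier (dz h) (k - 1) s - circleFourier (dzbar h) (k + 1) s) := by
  obtain ⟨h1, h2⟩ := continuousOn_dz_and_dzbar hh
  have c1 := continuous_circle_of_lt_one h1 ⟨hs.1.le, hs.2⟩
  have c2 := continuous_circle_of_lt_one h2 ⟨hs.1.le, hs.2⟩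
  have he : ∀ t : ℝ, HasDerivAt (fun t : ℝ => exp (-(k * t * I)))
      (exp (-(k * t * I)) * (-(k * I))) t := fun t => by
    have h0 : HasDerivAt (fun x : ℝ => -((k : ℂ) * x * I)) (-(k * I)) t := by
      simpa using (((ofRealCLM.hasDerivAt (x := t)).const_mul (k : ℂ)).mul_const I).fun_neg
    exact h0.cexp
  have parts := intervalIntegral.integral_deriv_mul_eq_sub
    (a := 0) (b := 2 * Real.pi)
    (fun t _ => hasDerivAt_angular hh hs t) (fun t _ => he t)
    (Continuous.intervalIntegrable (by fun_prop) _ _)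
    (Continuous.intervalIntegrable (by fun_prop) _ _)
  have hp : exp (((2 * Real.pi : ℝ) : ℂ) * I) = 1 := by push_cast; exact exp_two_pi_mul_I
  have hp' : exp (-((k : ℂ) * ((2 * Real.pi : ℝ) : ℂ) * I)) = 1 := by
    rw [exp_eq_one_iff]; exact ⟨-k, by push_cast; ring⟩
  have hc := continuous_circle_of_lt_one hh.continuousOn ⟨hs.1.le, hs.2⟩
  have hc2 : Continuous fun t : ℝ =>
      h (s * exp (t * I)) * (exp (-(k * t * I)) * (-(k * I))) := hc.mul (by fun_prop)
  rw [hp, hp', intervalIntegral.integral_add (Continuous.intervalIntegrable (by fun_prop) _ _)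
    (hc2.intervalIntegrable _ _), integral_angular_deriv hh k hs] at parts
  have e3 : ∫ t in (0 : ℝ)..(2 * Real.pi), h (s * exp (t * I)) * (exp (-(k * t * I)) * (-(k * I)))
      = -(k * I) * circleFourier h k s := by
    rw [circleFourier, ← intervalIntegral.integral_const_mul]
    congr 1 with t
    ring
  rw [e3] at parts
  simp only [ofReal_zero, zero_mul, mul_zero, neg_zero, exp_zero, mul_one, sub_self] at parts
  linear_combination I * parts + (s * (circleFourier (dz h) (k - 1) s -
    circleFourier (dzbar h) (k + 1) s) - k * circleFourier h k s) * (-I_sq)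

/-- The radial derivative is the sum of the coefficients of `dz h` and `dzbar h`, while
`mul_circleFourier_eq` gives their difference. Eliminating one of the two yields this lemma and the
next. -/
lemma hasDerivAt_circleFourier_dz {h : ℂ → ℂ} (hh : ContDiffOn ℝ 1 h (Metric.ball 0 1)) (k : ℤ)
    {s : ℝ} (hs : s ∈ Ioo (0 : ℝ) 1) :
    HasDerivAt (circleFourier h k)
      (-k / s * circleFourier h k s + 2 * circleFourier (dz h) (k - 1) s) s := by
  refine (hasDerivAt_circleFourier hh k hs).congr_deriv ?_
  have := mul_circleFourier_eq hh k hs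
  have hs0 : (s : ℂ) ≠ 0 := ofReal_ne_zero.2 hs.1.ne'
  field_simp
  linear_combination this

lemma hasDerivAt_circleFourier_dzbar {h : ℂ → ℂ} (hh : ContDiffOn ℝ 1 h (Metric.ball 0 1)) (k : ℤ)
    {s : ℝ} (hs : s ∈ Ioo (0 : ℝ) 1) :
    HasDerivAt (circleFourier h k)
      (k / s * circleFourier h k s + 2 * circleFourier (dzbar h) (k + 1) s) s := by
  refine (hasDerivAt_circleFourier hh k hs).congr_deriv ?_
  have := mul_circleFourier_eq hh k hs
  have hs0 : (s : ℂ) ≠ 0 := ofReal_ne_zero.2 hs.1.ne'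
  field_simp
  linear_combination -this

/-! ### The radial system. -/

/-- A bound for solutions of the first order system that is equivalent to
`A'' + A' / s - (n / s)² A = G`. -/
lemma norm_le_of_radial_system {n : ℕ} (hn : 1 ≤ n) {R : ℝ} (hR : 0 < R) {A P G : ℝ → ℂ}
    (hA : ContinuousOn A (Icc 0 R)) (hP : ContinuousOn P (Icc 0 R)) (hG : ContinuousOn G (Icc 0 R))
    (hA' : ∀ s ∈ Ioo 0 R, HasDerivAt A (-(n : ℂ) / s * A s + 2 * P s) s)
    (hP' : ∀ s ∈ Ioo 0 R, HasDerivAt P (((n : ℂ) - 1) / s * P s + G s / 2) s)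
    {c : ℝ} (hc : ∀ s ∈ Icc 0 R, ‖G s‖ ≤ c) :
    ‖A R‖ ≤ (∫ s in (0 : ℝ)..R, ‖P s‖) + c * R ^ 2 / 4 := by
  have hn0 : (n : ℂ) ≠ 0 := by exact_mod_cast (by omega : n ≠ 0)
  have hR0 : (R : ℂ) ≠ 0 := ofReal_ne_zero.2 hR.ne'
  -- The weight satisfies `w' = (n/s) w`, which cancels the `A`-terms in the derivative of `w A - (w
  -- - 1)/n · s P`. In that derivative the coefficient of `P` collapses to `1`. Since `w 0 = 0` and
  -- `w R = 1`, the function itself goes from `0` to `A R`.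
  set w : ℝ → ℂ := fun s => ((s : ℂ) / R) ^ n with hw
  have hwc : Continuous w := by fun_prop
  have hw' : ∀ s ∈ Ioo 0 R, HasDerivAt w (n / s * w s) s := by
    intro s hs
    have hs0 : (s : ℂ) ≠ 0 := ofReal_ne_zero.2 hs.1.ne'
    have h1 : HasDerivAt (fun x : ℝ => (x : ℂ) / R) (1 / R) s := by
      simpa using (ofRealCLM.hasDerivAt (x := s)).div_const (R : ℂ)
    refine (h1.fun_pow n).congr_deriv ?_
    obtain ⟨m, rfl⟩ : ∃ m, n = m + 1 := ⟨n - 1, by omega⟩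
    simp only [hw, add_tsub_cancel_right, pow_succ]
    field_simp
  set H' : ℝ → ℂ := fun s => P s - (w s - 1) / n * s * G s / 2 with hH'
  have hH'c : ContinuousOn H' (Icc 0 R) :=
    hP.sub (((((hwc.continuousOn.sub continuousOn_const).div_const _).mul
      continuous_ofReal.continuousOn).mul hG).div_const _)
  have hid : ContinuousOn (fun s : ℝ => (s : ℂ)) (Icc 0 R) := continuous_ofReal.continuousOn
  have hint : ∫ s in (0 : ℝ)..R, H' s = A R := by
    have := intervalIntegral.integral_eq_sub_of_hasDerivAt_of_le hR.le
      (f := fun s => w s * A s - (w s - 1) / n * s * P s) (f' := H')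
      ((hwc.continuousOn.mul hA).sub
        ((((hwc.continuousOn.sub continuousOn_const).div_const _).mul hid).mul hP)) ?_
      (hH'c.intervalIntegrable_of_Icc hR.le)
    · rw [this]
      have e1 : w R = 1 := by simp [hw, hR0]
      have e0 : w 0 = 0 := by
        simp only [hw, ofReal_zero, zero_div]
        exact zero_pow (by omega)
      simp [e1, e0]
    · intro s hs
      have hs0 : (s : ℂ) ≠ 0 := ofReal_ne_zero.2 hs.1.ne'
      have hi : HasDerivAt (fun x : ℝ => (x : ℂ)) 1 s := 
        (ofRealCLM.hasDerivAt (x := s)).congr_deriv (by simp)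
      refine (((hw' s hs).mul (hA' s hs)).sub
        (((((hw' s hs).sub_const 1).div_const (n : ℂ)).mul hi).mul (hP' s hs))).congr_deriv ?_
      simp only [hH', Pi.mul_apply]
      field_simp
      ring
  rw [← hint]
  have hPi : IntervalIntegrable (fun s => ‖P s‖) volume 0 R :=
    hP.norm.intervalIntegrable_of_Icc hR.le
  have hsi : IntervalIntegrable (fun s : ℝ => c / 2 * s) volume 0 R :=
    Continuous.intervalIntegrable (by fun_prop) _ _
  refine (intervalIntegral.norm_integral_le_of_norm_le (g := fun s => ‖P s‖ + c / 2 * s) hR.le ?_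
    (hPi.add hsi)).trans_eq ?_
  · refine Filter.Eventually.of_forall fun s hs => (norm_sub_le _ _).trans ?_
    have hs' : s ∈ Icc 0 R := ⟨hs.1.le, hs.2⟩
    have hu : 0 ≤ s / R := div_nonneg hs'.1 hR.le
    have hu1 : s / R ≤ 1 := (div_le_one hR).2 hs'.2
    have hww : w s - 1 = (((s / R) ^ n - 1 : ℝ) : ℂ) := by simp [hw]
    have hw1 : ‖w s - 1‖ ≤ 1 := by
      rw [hww, norm_real, Real.norm_eq_abs, abs_le]
      constructor
      · linarith [pow_nonneg hu n]
      · linarith [pow_le_one₀ hu hu1 (n := n)]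
    have hn1 : (1 : ℝ) ≤ n := by exact_mod_cast hn
    -- A crude bound, uniform in `n`; it leaves `c s / 2` to integrate, hence `c R² / 4`.
    have hd : ‖w s - 1‖ / n ≤ 1 := (div_le_one (by linarith)).2 (hw1.trans hn1)
    have : ‖(w s - 1) / n * s * G s / 2‖ = ‖w s - 1‖ / n * (s * ‖G s‖) / 2 := by
      simp only [norm_div, norm_mul, norm_real, Real.norm_of_nonneg hs'.1, Complex.norm_natCast,
        Complex.norm_ofNat]
      ring
    rw [this]
    have h3 : s * ‖G s‖ ≤ s * c := mul_le_mul_of_nonneg_left (hc s hs') hs'.1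
    have h4 : ‖w s - 1‖ / n * (s * ‖G s‖) ≤ 1 * (s * ‖G s‖) :=
      mul_le_mul_of_nonneg_right hd (mul_nonneg hs'.1 (norm_nonneg _))
    linarith
  · rw [intervalIntegral.integral_add hPi hsi, intervalIntegral.integral_const_mul, integral_id]
    ring

/-! ### The distortion inequality. -/

lemma norm_dz_add_norm_dzbar_le (f : ℂ → ℂ) (z : ℂ) :
    ‖dz f z‖ + ‖dzbar f z‖ ≤ ‖fderiv ℝ f z‖ := by
  set p := dz f z with hp
  set q := dzbar f z with hq
  -- In the direction `e^{iφ}` both terms `p e^{iφ}` and `q e^{-iφ}` have argument `(arg p + arg q)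
  -- / 2`, so their moduli add.
  set φ : ℝ := (q.arg - p.arg) / 2 with hφ
  have h1 := (fderiv ℝ f z).le_opNorm (exp (φ * I))
  rw [norm_exp_ofReal_mul_I, mul_one, fderiv_apply_eq_dz_add_dzbar, conj_exp_ofReal_mul_I] at h1
  have h2 : p * exp (φ * I) + q * exp (-(φ * I)) =
      ((‖p‖ + ‖q‖ : ℝ) : ℂ) * exp ((((p.arg + q.arg) / 2 : ℝ) : ℂ) * I) := by
    conv_lhs => rw [← norm_mul_exp_arg_mul_I p, ← norm_mul_exp_arg_mul_I q]
    rw [mul_assoc, mul_assoc, ← exp_add, ← exp_add, ofReal_add, add_mul]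
    congr 3
    · simp only [hφ]; push_cast; ring
    · simp only [hφ]; push_cast; ring
  rw [← hp, ← hq, h2, norm_mul, norm_exp_ofReal_mul_I, mul_one, norm_real,
    Real.norm_of_nonneg (by positivity)] at h1
  exact h1

lemma det_fderiv_eq (f : ℂ → ℂ) (z : ℂ) :
    (fderiv ℝ f z).det = ‖dz f z‖ ^ 2 - ‖dzbar f z‖ ^ 2 := by
  rw [ContinuousLinearMap.det, ← LinearMap.det_toMatrix basisOneI, Matrix.det_fin_two]
  simp only [LinearMap.toMatrix_apply, coe_basisOneI, coe_basisOneI_repr,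
    ContinuousLinearMap.coe_coe, fderiv_apply_eq_dz_add_dzbar, Matrix.cons_val_zero,
    Matrix.cons_val_one, Complex.sq_norm, normSq_apply]
  simp
  ring

/-- Distortion gives `(|f_z| + |f_z̄|)² ≤ K (|f_z|² - |f_z̄|²)`. Dividing by the sum leaves `K
(|f_z| - |f_z̄|)`, which the reverse triangle inequality compares with any unimodular combination;
it is applied with `u = e^{-2it}`. -/
lemma IsQuasiconformalOn.norm_dz_add_norm_dzbar_le {K : ℝ} {f : ℂ → ℂ} {Ω : Set ℂ}
    (hf : IsQuasiconformalOn K f Ω) {z : ℂ} (hz : z ∈ Ω) {u : ℂ} (hu : ‖u‖ = 1) :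
    ‖dz f z‖ + ‖dzbar f z‖ ≤ K * ‖dz f z + u * dzbar f z‖ := by
  have h1 := PoissonQC.norm_dz_add_norm_dzbar_le f z
  have h2 := hf.distortion z hz
  have h3 := hf.sensePreserving z hz
  have hK := hf.one_le
  rw [abs_of_nonneg h3, det_fderiv_eq] at h2
  have h4 : ‖dz f z‖ - ‖dzbar f z‖ ≤ ‖dz f z + u * dzbar f z‖ := by
    have := norm_sub_norm_le (dz f z) (-(u * dzbar f z))
    rwa [sub_neg_eq_add, norm_neg, norm_mul, hu, one_mul] at this
  have h5 : (‖dz f z‖ + ‖dzbar f z‖) ^ 2 ≤ ‖fderiv ℝ f z‖ ^ 2 :=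
    pow_le_pow_left₀ (by positivity) h1 2
  refine le_trans ?_ (mul_le_mul_of_nonneg_left h4 (by linarith))
  -- The division needs a nonzero sum; if the sum vanishes, so do both derivatives.
  rcases (add_nonneg (norm_nonneg (dz f z)) (norm_nonneg (dzbar f z))).eq_or_lt with h0 | h0
  · have := norm_nonneg (dz f z)
    have := norm_nonneg (dzbar f z)
    have e1 : ‖dz f z‖ = 0 := by linarith
    have e2 : ‖dzbar f z‖ = 0 := by linarith
    simp [e1, e2]
  · refine le_of_mul_le_mul_right ?_ h0
    nlinarith

/-! ### Estimates on circles of radius `R < 1`. -/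

lemma le_supNorm {g : ℂ → ℂ} (hg : ContinuousOn g (Metric.closedBall 0 1)) {z : ℂ}
    (hz : ‖z‖ ≤ 1) : ‖g z‖ ≤ supNorm g :=
  le_csSup ((isCompact_closedBall 0 1).bddAbove_image hg.norm)
    ⟨z, mem_closedBall_zero_iff.2 hz, rfl⟩

lemma norm_circleFourier_le_supNorm {g : ℂ → ℂ} (hg : ContinuousOn g (Metric.closedBall 0 1))
    (k : ℤ) {s : ℝ} (hs : s ∈ Icc (0 : ℝ) 1) :
    ‖circleFourier g k s‖ ≤ 2 * Real.pi * supNorm g := by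
  have := intervalIntegral.norm_integral_le_of_norm_le_const (a := 0) (b := 2 * Real.pi)
    (f := fun t : ℝ => g (s * exp (t * I)) * exp (-(k * t * I))) (C := supNorm g) fun t _ => by
      rw [norm_mul, norm_exp_neg_int_mul, mul_one]
      exact le_supNorm hg ((norm_ofReal_mul_exp hs.1 t).trans_le hs.2)
  rw [sub_zero, abs_of_pos Real.two_pi_pos] at this
  exact this.trans_eq (mul_comm _ _)

lemma radialLength_le {f : ℂ → ℂ} {M : ℝ≥0} (hM : supRadialLength f = (M : ℝ≥0∞)) {r θ : ℝ}
    (hr : r ∈ Ico (0 : ℝ) 1) (hθ : θ ∈ Icc (0 : ℝ) (2 * Real.pi)) : radialLength f r θ ≤ M := by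
  have h1 : ENNReal.ofReal (radialLength f r θ) ≤ radialLengthOne f θ :=
    le_iSup₂ (f := fun r (_ : r ∈ Ico (0 : ℝ) 1) => ENNReal.ofReal (radialLength f r θ)) r hr
  have h2 : radialLengthOne f θ ≤ supRadialLength f :=
    le_iSup₂ (f := fun θ (_ : θ ∈ Icc (0 : ℝ) (2 * Real.pi)) => radialLengthOne f θ) θ hθ
  have h3 := h1.trans (h2.trans_eq hM)
  rw [← ENNReal.ofReal_coe_nnreal] at h3
  exact (ENNReal.ofReal_le_ofReal_iff M.2).1 h3

lemma circleFourier_congr {h₁ h₂ : ℂ → ℂ} (k : ℤ) {s : ℝ} (hs : s ∈ Ico (0 : ℝ) 1)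
    (h : ∀ z ∈ Metric.ball (0 : ℂ) 1, h₁ z = h₂ z) :
    circleFourier h₁ k s = circleFourier h₂ k s := by
  unfold circleFourier
  congr 1 with t
  rw [h _ (by rw [mem_ball_zero_iff, norm_ofReal_mul_exp hs.1]; exact hs.2)]

lemma circleFourier_div (h : ℂ → ℂ) (c : ℂ) (k : ℤ) (s : ℝ) :
    circleFourier (fun z => h z / c) k s = circleFourier h k s / c := by
  unfold circleFourier
  rw [← intervalIntegral.integral_div]
  congr 1 with t
  ring

lemma norm_circleFourier_add_le_integral {g f : ℂ → ℂ}
    (hg : ContinuousOn g (Metric.closedBall 0 1)) (hf : IsPoissonSolution g f) {n : ℕ}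
    (hn : 1 ≤ n) {R : ℝ} (hR : R ∈ Ioo (0 : ℝ) 1) :
    ‖circleFourier f n R‖ + ‖circleFourier f (-n) R‖ ≤
      (∫ s in (0 : ℝ)..R, (‖circleFourier (dz f) (n - 1) s‖ +
        ‖circleFourier (dzbar f) (1 - n) s‖)) + Real.pi * supNorm g := by
  have hsub := Metric.closedBall_subset_ball (x := (0 : ℂ)) hR.2
  have hf2 := hf.contDiffOn
  have hf1 : ContDiffOn ℝ 1 f (Metric.ball 0 1) := hf2.of_le (by norm_num)
  have hp1 : ContDiffOn ℝ 1 (dz f) (Metric.ball 0 1) :=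
    contDiffOn_dz (m := 1) Metric.isOpen_ball (by norm_num; exact hf2)
  have hq1 : ContDiffOn ℝ 1 (dzbar f) (Metric.ball 0 1) :=
    contDiffOn_dzbar (m := 1) Metric.isOpen_ball (by norm_num; exact hf2)
  have cont : ∀ {h : ℂ → ℂ} (_ : ContDiffOn ℝ 1 h (Metric.ball 0 1)) (k : ℤ),
      ContinuousOn (circleFourier h k) (Icc 0 R) := fun hh k =>
    continuousOn_circleFourier hR.1.le (hh.continuousOn.mono hsub) k
  have contg : ∀ k : ℤ, ContinuousOn (circleFourier g k) (Icc 0 R) := fun k =>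
    continuousOn_circleFourier hR.1.le (hg.mono (hsub.trans Metric.ball_subset_closedBall)) k
  have bound : ∀ k : ℤ, ∀ s ∈ Icc 0 R, ‖circleFourier g k s‖ ≤ 2 * Real.pi * supNorm g :=
    fun k s hs => norm_circleFourier_le_supNorm hg k ⟨hs.1, hs.2.trans hR.2.le⟩
  have lt1 : ∀ s ∈ Ioo 0 R, s ∈ Ioo (0 : ℝ) 1 := fun s hs => ⟨hs.1, hs.2.trans hR.2⟩
  have hA := norm_le_of_radial_system hn hR.1 (cont hf1 n) (cont hp1 (n - 1)) (contg n)
    (fun s hs => by simpa using hasDerivAt_circleFourier_dz hf1 n (lt1 s hs))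
    (fun s hs => by
      have := hasDerivAt_circleFourier_dzbar hp1 (n - 1) (lt1 s hs)
      rw [circleFourier_congr (h₁ := dzbar (dz f)) (h₂ := fun z => g z / 4) _ ⟨hs.1.le, (lt1 s hs).2⟩ (fun z hz => by
        rw [(dzbar_dz_and_dz_dzbar Metric.isOpen_ball hf2 hz).1, hf.laplacian_eq z hz]),
        circleFourier_div, sub_add_cancel] at this
      refine this.congr_deriv ?_
      push_cast
      ring)
    (bound n)
  -- At index `-n` the two Wirtinger derivatives exchange roles, and the signs again give `-n/s` and
  -- `(n-1)/s`.
  have hB := norm_le_of_radial_system hn hR.1 (cont hf1 (-n)) (cont hq1 (1 - n)) (contg (-n))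
    (fun s hs => by
      have := hasDerivAt_circleFourier_dzbar hf1 (-n) (lt1 s hs)
      rw [neg_add_eq_sub] at this
      simpa using this)
    (fun s hs => by
      have := hasDerivAt_circleFourier_dz hq1 (1 - n) (lt1 s hs)
      rw [circleFourier_congr (h₁ := dz (dzbar f)) (h₂ := fun z => g z / 4) _ ⟨hs.1.le, (lt1 s hs).2⟩ (fun z hz => by
        rw [(dzbar_dz_and_dz_dzbar Metric.isOpen_ball hf2 hz).2, hf.laplacian_eq z hz]),
        circleFourier_div, sub_sub_cancel_left] at this
      refine this.congr_deriv ?_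
      push_cast
      ring)
    (bound (-n))
  rw [intervalIntegral.integral_add ((cont hp1 _).norm.intervalIntegrable_of_Icc hR.1.le)
    ((cont hq1 _).norm.intervalIntegrable_of_Icc hR.1.le)]
  have hg0 : 0 ≤ supNorm g := (norm_nonneg _).trans (le_supNorm hg (z := 0) (by simp))
  have hR2 : R ^ 2 ≤ 1 := pow_le_one₀ hR.1.le hR.2.le
  have : Real.pi * supNorm g * R ^ 2 ≤ Real.pi * supNorm g * 1 :=
    mul_le_mul_of_nonneg_left hR2 (mul_nonneg Real.pi_pos.le hg0)
  linarith

lemma norm_exp_neg_two_mul (t : ℝ) : ‖exp (-2 * t * I)‖ = 1 := by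
  have : (-2 * t * I : ℂ) = ((-2 * t : ℝ) : ℂ) * I := by push_cast; ring
  rw [this, norm_exp_ofReal_mul_I]

lemma norm_circleFourier_add_le {g f : ℂ → ℂ} {K : ℝ} {M : ℝ≥0}
    (hg : ContinuousOn g (Metric.closedBall 0 1)) (hf : IsPoissonSolution g f)
    (hq : IsQuasiconformalOn K f (Metric.ball 0 1)) (hM : supRadialLength f = (M : ℝ≥0∞)) {n : ℕ}
    (hn : 1 ≤ n) {R : ℝ} (hR : R ∈ Ioo (0 : ℝ) 1) :
    ‖circleFourier f n R‖ + ‖circleFourier f (-n) R‖ ≤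
      2 * Real.pi * (K * M) + Real.pi * supNorm g := by
  refine (norm_circleFourier_add_le_integral hg hf hn hR).trans (add_le_add_left ?_ _)
  have hsub := Metric.closedBall_subset_ball (x := (0 : ℂ)) hR.2
  have hK : 0 ≤ K := zero_le_one.trans hq.one_le
  obtain ⟨h1, h2⟩ := continuousOn_dz_and_dzbar hq.contDiffOn
  have c1 := continuous_polar_clamp hR.1.le (h1.mono hsub)
  have c2 := continuous_polar_clamp hR.1.le (h2.mono hsub)
  -- A jointly continuous version of the radial length integrand, clamped in the radius, for Fubini
  -- and for the continuity of the inner integrals.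
  obtain ⟨N, hNc, hN⟩ : ∃ N : ℝ → ℝ → ℝ, Continuous (Function.uncurry N) ∧
      ∀ s ∈ Icc 0 R, ∀ t : ℝ, N s t =
        ‖dz f (s * exp (t * I)) + exp (-2 * t * I) * dzbar f (s * exp (t * I))‖ := by
    refine ⟨fun s t => ‖dz f ((max 0 (min s R) : ℝ) * exp (t * I)) +
      exp (-2 * t * I) * dzbar f ((max 0 (min s R) : ℝ) * exp (t * I))‖, ?_, fun s hs t => by
        simp only [clamp_eq hs]⟩
    exact (c1.add (Continuous.mul (by fun_prop) c2)).norm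
  have hNi : Continuous fun s : ℝ => ∫ t in (0 : ℝ)..(2 * Real.pi), K * N s t := by
    apply intervalIntegral.continuous_parametric_intervalIntegral_of_continuous'
    exact continuous_const.mul hNc
  have hN2 : Continuous fun t : ℝ => ∫ s in (0 : ℝ)..R, N s t := by
    apply intervalIntegral.continuous_parametric_intervalIntegral_of_continuous'
    exact hNc.comp continuous_swap
  have step1 : ∀ s ∈ Icc 0 R, ‖circleFourier (dz f) (n - 1) s‖ +
      ‖circleFourier (dzbar f) (1 - n) s‖ ≤ ∫ t in (0 : ℝ)..(2 * Real.pi), K * N s t := by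
    intro s hs
    have hs1 : s ∈ Ico (0 : ℝ) 1 := ⟨hs.1, hs.2.trans_lt hR.2⟩
    have d1 := continuous_circle_of_lt_one h1 hs1
    have d2 := continuous_circle_of_lt_one h2 hs1
    refine (add_le_add (norm_circleFourier_le _ _) (norm_circleFourier_le _ _)).trans ?_
    rw [← intervalIntegral.integral_add (d1.norm.intervalIntegrable _ _)
      (d2.norm.intervalIntegrable _ _)]
    refine intervalIntegral.integral_mono_on Real.two_pi_pos.le
      ((d1.norm.add d2.norm).intervalIntegrable _ _)
      ((continuous_const.mul (hNc.comp (Continuous.prodMk_right s))).intervalIntegrable _ _) ?_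
    intro t _
    rw [hN s hs]
    exact hq.norm_dz_add_norm_dzbar_le
      (by rw [mem_ball_zero_iff, norm_ofReal_mul_exp hs.1]; exact hs1.2) (norm_exp_neg_two_mul t)
  have hcf : ∀ {h : ℂ → ℂ} (_ : ContinuousOn h (Metric.ball 0 1)) (k : ℤ),
      ContinuousOn (circleFourier h k) (Icc 0 R) := fun hh k =>
    continuousOn_circleFourier hR.1.le (hh.mono hsub) k
  calc _ ≤ ∫ s in (0 : ℝ)..R, ∫ t in (0 : ℝ)..(2 * Real.pi), K * N s t :=
        intervalIntegral.integral_mono_on hR.1.le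
          (((hcf h1 _).norm.add (hcf h2 _).norm).intervalIntegrable_of_Icc hR.1.le)
          (hNi.intervalIntegrable _ _) step1
    _ = K * ∫ s in (0 : ℝ)..R, ∫ t in (0 : ℝ)..(2 * Real.pi), N s t := by
        simp only [intervalIntegral.integral_const_mul]
    _ = K * ∫ t in (0 : ℝ)..(2 * Real.pi), ∫ s in (0 : ℝ)..R, N s t := by
        rw [intervalIntegral_intervalIntegral_swap]
        exact (hNc.continuousOn.integrableOn_compact (isCompact_uIcc.prod isCompact_uIcc)).mono_set
          (prod_mono uIoc_subset_uIcc uIoc_subset_uIcc)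
    _ ≤ K * ∫ _ in (0 : ℝ)..(2 * Real.pi), (M : ℝ) := by
        refine mul_le_mul_of_nonneg_left ?_ hK
        refine intervalIntegral.integral_mono_on Real.two_pi_pos.le
          (hN2.intervalIntegrable _ _) intervalIntegrable_const fun t ht => ?_
        refine le_trans (le_of_eq ?_) (radialLength_le hM ⟨hR.1.le, hR.2⟩ ht)
        refine intervalIntegral.integral_congr fun s hs => ?_
        rw [uIcc_of_le hR.1.le] at hs
        exact hN s hs t
    _ = 2 * Real.pi * (K * M) := by
        rw [intervalIntegral.integral_const, smul_eq_mul]; ring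

/-! ### Harmonic expansions and the uniqueness of their coefficients. -/

lemma integral_exp_int_mul (j : ℤ) :
    ∫ t in (0 : ℝ)..(2 * Real.pi), exp (j * t * I) = if j = 0 then (2 * Real.pi : ℂ) else 0 := by
  split_ifs with hj
  · simp [hj]
  · have hc : (j : ℂ) * I ≠ 0 := mul_ne_zero (by exact_mod_cast hj) I_ne_zero
    have h1 : ∀ t : ℝ, exp ((j : ℂ) * t * I) = exp ((j : ℂ) * I * t) := fun t => by ring_nf
    have h2 : exp ((j : ℂ) * I * ((2 * Real.pi : ℝ) : ℂ)) = 1 :=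
      exp_eq_one_iff.2 ⟨j, by push_cast; ring⟩
    simp only [h1]
    rw [integral_exp_mul_complex hc, h2]
    simp

/-- The `n`-th term of a harmonic expansion. -/
noncomputable def harmonicTerm (a b : ℕ → ℂ) (n : ℕ) (z : ℂ) : ℂ :=
  a n * z ^ n + starRingEnd ℂ (b (n + 1)) * starRingEnd ℂ z ^ (n + 1)

lemma HasHarmonicExpansion.hasSum {h : ℂ → ℂ} {a b : ℕ → ℂ} (H : HasHarmonicExpansion h a b)
    {z : ℂ} (hz : ‖z‖ < 1) : HasSum (fun n => harmonicTerm a b n z) (h z) := by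
  obtain ⟨s, t, hs, ht, hst⟩ := H z (mem_ball_zero_iff.2 hz)
  rw [hst]
  exact hs.add ht

lemma HasHarmonicExpansion.summable {h : ℂ → ℂ} {a b : ℕ → ℂ} (H : HasHarmonicExpansion h a b)
    {r : ℝ} (hr : r ∈ Ico (0 : ℝ) 1) :
    Summable fun n => ‖a n‖ * r ^ n + ‖b (n + 1)‖ * r ^ (n + 1) := by
  have hn : ‖(r : ℂ)‖ = r := by rw [norm_real, Real.norm_of_nonneg hr.1]
  obtain ⟨s, t, hs, ht, -⟩ := H r (mem_ball_zero_iff.2 (hn.trans_lt hr.2))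
  have h1 := hs.summable.norm
  have h2 := ht.summable.norm
  simp only [norm_mul, norm_pow, RCLike.norm_conj, hn] at h1 h2
  exact h1.add h2

lemma norm_harmonicTerm_le (a b : ℕ → ℂ) (n : ℕ) (z : ℂ) :
    ‖harmonicTerm a b n z‖ ≤ ‖a n‖ * ‖z‖ ^ n + ‖b (n + 1)‖ * ‖z‖ ^ (n + 1) := by
  refine (norm_add_le _ _).trans_eq ?_
  simp only [norm_mul, norm_pow, RCLike.norm_conj]

lemma circleFourier_harmonicTerm (a b : ℕ → ℂ) (n : ℕ) (k : ℤ) (r : ℝ) :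
    circleFourier (harmonicTerm a b n) k r =
      (if (n : ℤ) = k then 2 * Real.pi * (a n * r ^ n) else 0) +
      (if -((n : ℤ) + 1) = k then
        2 * Real.pi * (starRingEnd ℂ (b (n + 1)) * r ^ (n + 1)) else 0) := by
  have h : ∀ t : ℝ, harmonicTerm a b n (r * exp (t * I)) * exp (-(k * t * I)) =
      a n * r ^ n * exp (((n - k : ℤ) : ℂ) * t * I) + starRingEnd ℂ (b (n + 1)) * r ^ (n + 1) *
        exp (((-((n : ℤ) + 1) - k : ℤ) : ℂ) * t * I) := by
    intro t
    have e1 : exp (((n - k : ℤ) : ℂ) * t * I) = exp (t * I) ^ n * exp (-(k * t * I)) := by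
      rw [← exp_nat_mul, ← exp_add]; congr 1; push_cast; ring
    have e2 : exp (((-((n : ℤ) + 1) - k : ℤ) : ℂ) * t * I) =
        exp (-(t * I)) ^ (n + 1) * exp (-(k * t * I)) := by
      rw [← exp_nat_mul, ← exp_add]; congr 1; push_cast; ring
    rw [e1, e2, harmonicTerm, map_mul, conj_exp_ofReal_mul_I, conj_ofReal, mul_pow, mul_pow]
    ring
  unfold circleFourier
  simp only [h]
  rw [intervalIntegral.integral_add (Continuous.intervalIntegrable (by fun_prop) _ _)
    (Continuous.intervalIntegrable (by fun_prop) _ _), intervalIntegral.integral_const_mul,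
    intervalIntegral.integral_const_mul, integral_exp_int_mul, integral_exp_int_mul]
  simp only [sub_eq_zero]
  congr 1 <;> split_ifs <;> ring

/-- Convergence at the real point `r` is absolute, which dominates the series on the whole circle of
radius `r` and permits termwise integration. -/
lemma HasHarmonicExpansion.hasSum_circleFourier {h : ℂ → ℂ} {a b : ℕ → ℂ}
    (H : HasHarmonicExpansion h a b) {r : ℝ} (hr : r ∈ Ico (0 : ℝ) 1) (k : ℤ) :
    HasSum (fun n => circleFourier (harmonicTerm a b n) k r) (circleFourier h k r) := by
  refine intervalIntegral.hasSum_integral_of_dominated_convergence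
    (fun n _ => ‖a n‖ * r ^ n + ‖b (n + 1)‖ * r ^ (n + 1)) (fun n => ?_) (fun n => ?_) ?_ ?_ ?_
  · refine Continuous.aestronglyMeasurable ?_
    unfold harmonicTerm
    fun_prop
  · refine Filter.Eventually.of_forall fun t _ => ?_
    rw [norm_mul, norm_exp_neg_int_mul, mul_one]
    refine (norm_harmonicTerm_le a b n _).trans_eq ?_
    rw [norm_ofReal_mul_exp hr.1]
  · exact Filter.Eventually.of_forall fun t _ => H.summable hr
  · exact intervalIntegrable_const
  · exact Filter.Eventually.of_forall fun t _ =>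
      (H.hasSum ((norm_ofReal_mul_exp hr.1 t).trans_lt hr.2)).mul_right _

lemma HasHarmonicExpansion.circleFourier_natCast {h : ℂ → ℂ} {a b : ℕ → ℂ}
    (H : HasHarmonicExpansion h a b) {r : ℝ} (hr : r ∈ Ico (0 : ℝ) 1) (m : ℕ) :
    circleFourier h m r = 2 * Real.pi * (a m * r ^ m) := by
  refine (H.hasSum_circleFourier hr m).unique ?_
  have := hasSum_single (f := fun n => circleFourier (harmonicTerm a b n) m r) m fun n hn => ?_
  · rwa [circleFourier_harmonicTerm, if_pos rfl, if_neg (by omega), add_zero] at this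
  · rw [circleFourier_harmonicTerm, if_neg (by omega), if_neg (by omega), add_zero]

lemma HasHarmonicExpansion.circleFourier_neg_natCast {h : ℂ → ℂ} {a b : ℕ → ℂ}
    (H : HasHarmonicExpansion h a b) {r : ℝ} (hr : r ∈ Ico (0 : ℝ) 1) (m : ℕ) :
    circleFourier h (-((m : ℤ) + 1)) r =
      2 * Real.pi * (starRingEnd ℂ (b (m + 1)) * r ^ (m + 1)) := by
  refine (H.hasSum_circleFourier hr _).unique ?_
  have := hasSum_single (f := fun n => circleFourier (harmonicTerm a b n) (-((m : ℤ) + 1)) r) m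
    fun n hn => ?_
  · rwa [circleFourier_harmonicTerm, if_neg (by omega), if_pos rfl, zero_add] at this
  · rw [circleFourier_harmonicTerm, if_neg (by omega), if_neg (by omega), add_zero]

lemma HasHarmonicExpansion.unique {h : ℂ → ℂ} {a b a' b' : ℕ → ℂ}
    (H : HasHarmonicExpansion h a b) (H' : HasHarmonicExpansion h a' b') {n : ℕ} (hn : 1 ≤ n) :
    a n = a' n ∧ b n = b' n := by
  -- Any radius in `(0, 1)` would do: the Fourier coefficients on one circle determine the
  -- expansion.
  have hr : (1 / 2 : ℝ) ∈ Ico (0 : ℝ) 1 := by norm_num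
  have hp : (2 * Real.pi : ℂ) ≠ 0 := by exact_mod_cast Real.two_pi_pos.ne'
  have hr0 : ((1 / 2 : ℝ) : ℂ) ≠ 0 := by norm_num
  obtain ⟨m, rfl⟩ : ∃ m, n = m + 1 := ⟨n - 1, by omega⟩
  constructor
  · have := (H.circleFourier_natCast hr (m + 1)).symm.trans (H'.circleFourier_natCast hr (m + 1))
    exact mul_right_cancel₀ (pow_ne_zero _ hr0) (mul_left_cancel₀ hp this)
  · have := (H.circleFourier_neg_natCast hr m).symm.trans (H'.circleFourier_neg_natCast hr m)
    exact (starRingEnd ℂ).injective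
      (mul_right_cancel₀ (pow_ne_zero _ hr0) (mul_left_cancel₀ hp this))

/-! ### The expansion of the Poisson integral. -/

/-- With `w = z e^{-it}` these are two geometric series, and `1/(1-w) + w̄/(1-w̄) =
(1-|w|²)/|1-w|²`. -/
lemma hasSum_poissonKernel {z : ℂ} (hz : ‖z‖ < 1) (t : ℝ) :
    HasSum (fun n : ℕ => (z * exp (-(t * I))) ^ n + (starRingEnd ℂ z * exp (t * I)) ^ (n + 1))
      (poissonKernel 0 z (exp (t * I)) : ℂ) := by
  set e := exp (t * I) with he
  have he1 : ‖e‖ = 1 := norm_exp_ofReal_mul_I t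
  have hconj : exp (-(t * I)) = starRingEnd ℂ e := (conj_exp_ofReal_mul_I t).symm
  have hee : e * starRingEnd ℂ e = 1 := by rw [mul_conj', he1]; simp
  rw [hconj]
  set w := z * starRingEnd ℂ e with hw
  have hwc : starRingEnd ℂ z * e = starRingEnd ℂ w := by simp [hw]
  rw [hwc]
  have hw1 : ‖w‖ < 1 := by simpa [hw, he1] using hz
  have hwc1 : ‖starRingEnd ℂ w‖ < 1 := by simpa using hw1
  have h1 := hasSum_geometric_of_norm_lt_one hw1
  have h2 := (hasSum_geometric_of_norm_lt_one hwc1).mul_left (starRingEnd ℂ w)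
  simp only [← pow_succ'] at h2
  convert! h1.add h2 using 1
  have n1 : 1 - w ≠ 0 := fun h => by
    rw [← sub_eq_zero.1 h] at hw1; simp at hw1
  have n2 : 1 - starRingEnd ℂ w ≠ 0 := fun h => by
    rw [← sub_eq_zero.1 h] at hwc1; simp at hwc1
  have hd : (e - z) = e * (1 - w) := by
    rw [hw]; linear_combination z * hee
  have hwz : w * starRingEnd ℂ w = z * starRingEnd ℂ z := by
    simp only [hw, map_mul, conj_conj]; linear_combination z * starRingEnd ℂ z * hee
  rw [poissonKernel_def, sub_zero, sub_zero, he1, hd, norm_mul, he1, one_mul]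
  push_cast
  rw [← mul_conj', ← mul_conj', ← hwz, map_sub, map_one]
  field_simp
  ring

lemma hasHarmonicExpansion_poissonIntegral {ψ : ℂ → ℂ}
    (hψ : ContinuousOn ψ (Metric.closedBall 0 1)) :
    HasHarmonicExpansion (poissonIntegral ψ) (fun n => circleFourier ψ n 1 / (2 * Real.pi))
      (fun n => starRingEnd ℂ (circleFourier ψ (-n) 1 / (2 * Real.pi))) := by
  intro z hz
  have hz1 : ‖z‖ < 1 := mem_ball_zero_iff.1 hz
  have hz1c : ‖starRingEnd ℂ z‖ < 1 := by simpa using hz1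
  have hc : Continuous fun t : ℝ => ψ (exp (t * I)) := by
    simpa using continuous_circle (s := 1) ⟨zero_le_one, le_rfl⟩ hψ
  have bound : ∀ k : ℤ, ‖circleFourier ψ k 1 / (2 * Real.pi)‖ ≤ supNorm ψ := fun k => by
    have := norm_circleFourier_le_supNorm hψ k (s := 1) ⟨zero_le_one, le_rfl⟩
    have hp : ‖(2 * Real.pi : ℂ)‖ = 2 * Real.pi := by
      simp [abs_of_pos Real.pi_pos]
    rw [norm_div, hp, div_le_iff₀ Real.two_pi_pos, mul_comm]
    exact this
  have s1 : Summable fun n : ℕ => circleFourier ψ n 1 / (2 * Real.pi) * z ^ n := by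
    refine Summable.of_norm_bounded
      ((summable_geometric_of_lt_one (norm_nonneg z) hz1).mul_left (supNorm ψ)) fun n => ?_
    rw [norm_mul, norm_pow]
    exact mul_le_mul_of_nonneg_right (bound _) (by positivity)
  have s2 : Summable fun n : ℕ => circleFourier ψ (-(n + 1 : ℕ)) 1 / (2 * Real.pi) *
      starRingEnd ℂ z ^ (n + 1) := by
    refine Summable.of_norm_bounded
      (((summable_nat_add_iff 1).2 (summable_geometric_of_lt_one (norm_nonneg _) hz1c)).mul_left
        (supNorm ψ)) fun n => ?_
    rw [norm_mul, norm_pow]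
    exact mul_le_mul_of_nonneg_right (bound _) (by positivity)
  simp only [conj_conj]
  refine ⟨_, _, s1.hasSum, s2.hasSum, ?_⟩
  refine HasSum.unique ?_ (s1.hasSum.add s2.hasSum)
  have key : HasSum (fun n : ℕ => ∫ t in (0 : ℝ)..(2 * Real.pi),
      ((z * exp (-(t * I))) ^ n + (starRingEnd ℂ z * exp (t * I)) ^ (n + 1)) * ψ (exp (t * I)))
      (∫ t in (0 : ℝ)..(2 * Real.pi), (poissonKernel 0 z (exp (t * I)) : ℂ) * ψ (exp (t * I))) := by
    refine intervalIntegral.hasSum_integral_of_dominated_convergence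
      (fun n _ => (‖z‖ ^ n + ‖z‖ ^ (n + 1)) * supNorm ψ) (fun n => ?_) (fun n => ?_) ?_ ?_ ?_
    · exact Continuous.aestronglyMeasurable (Continuous.mul (by fun_prop) hc)
    · refine Filter.Eventually.of_forall fun t _ => ?_
      have e1 := norm_exp_ofReal_mul_I t
      have e2 : ‖exp (-(t * I))‖ = 1 := by simpa using norm_exp_neg_int_mul 1 t
      rw [norm_mul]
      refine mul_le_mul ((norm_add_le _ _).trans_eq ?_) (le_supNorm hψ e1.le) (norm_nonneg _)
        (by positivity)
      simp only [norm_pow, norm_mul, e1, e2, mul_one, RCLike.norm_conj]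
    · exact Filter.Eventually.of_forall fun t _ =>
        ((summable_geometric_of_lt_one (norm_nonneg z) hz1).add ((summable_nat_add_iff 1).2
          (summable_geometric_of_lt_one (norm_nonneg z) hz1))).mul_right _
    · exact intervalIntegrable_const
    · exact Filter.Eventually.of_forall fun t _ => (hasSum_poissonKernel hz1 t).mul_right _
  -- It remains to match terms: the `n`-th term of the kernel series picks out the Fourier
  -- coefficients of index `n` and `-(n + 1)`.
  convert! key.mul_left (((1 / (2 * Real.pi) : ℝ) : ℂ)) using 1
  funext n
  have e : ∀ t : ℝ,
      ((z * exp (-(t * I))) ^ n + (starRingEnd ℂ z * exp (t * I)) ^ (n + 1)) * ψ (exp (t * I)) =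
      z ^ n * (ψ (exp (t * I)) * exp (-(((n : ℕ) : ℤ) * t * I))) +
      starRingEnd ℂ z ^ (n + 1) * (ψ (exp (t * I)) *
        exp (-(((-((n + 1 : ℕ) : ℤ) : ℤ) : ℂ) * t * I))) := by
    intro t
    have e1 : exp (-(((n : ℕ) : ℤ) * t * I)) = exp (-(t * I)) ^ n := by
      rw [← exp_nat_mul]; congr 1; push_cast; ring
    have e2 : exp (-(((-((n + 1 : ℕ) : ℤ) : ℤ) : ℂ) * t * I)) = exp (t * I) ^ (n + 1) := by
      rw [← exp_nat_mul]; congr 1; push_cast; ring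
    rw [e1, e2]
    ring
  have hi : ∀ k : ℤ, IntervalIntegrable
      (fun t : ℝ => ψ (exp (t * I)) * exp (-(k * t * I))) volume 0 (2 * Real.pi) := fun k =>
    (hc.mul (by fun_prop)).intervalIntegrable _ _
  simp only [e]
  rw [intervalIntegral.integral_add ((hi _).const_mul _) ((hi _).const_mul _),
    intervalIntegral.integral_const_mul, intervalIntegral.integral_const_mul]
  simp only [circleFourier, ofReal_one, one_mul]
  push_cast
  ring

/-! ### Passage to the unit circle and the coefficient bound. -/

/-- The bound for `R < 1` does not depend on `R`, and continuity of `f` on the closed disk suffices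
for `R → 1`. -/
lemma norm_circleFourier_one_add_le {g f : ℂ → ℂ} {K : ℝ} {M : ℝ≥0}
    (hg : ContinuousOn g (Metric.closedBall 0 1)) (hf : IsPoissonSolution g f)
    (hq : IsQuasiconformalOn K f (Metric.ball 0 1)) (hM : supRadialLength f = (M : ℝ≥0∞)) {n : ℕ}
    (hn : 1 ≤ n) :
    ‖circleFourier f n 1‖ + ‖circleFourier f (-n) 1‖ ≤
      2 * Real.pi * (K * M) + Real.pi * supNorm g := by
  have hc : ∀ k : ℤ, ContinuousWithinAt (circleFourier f k) (Ioo 0 1) 1 := fun k =>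
    (continuousOn_circleFourier zero_le_one hf.continuousOn k 1 ⟨zero_le_one, le_rfl⟩).mono
      Ioo_subset_Icc_self
  have := right_nhdsWithin_Ioo_neBot (zero_lt_one (α := ℝ))
  refine le_of_tendsto ((hc n).norm.add (hc (-n)).norm) ?_
  filter_upwards [self_mem_nhdsWithin] with R hR
  exact norm_circleFourier_add_le hg hf hq hM hn hR

lemma norm_coeff_add_norm_coeff_le {g f : ℂ → ℂ} {K : ℝ} {M : ℝ≥0}
    (hg : ContinuousOn g (Metric.closedBall 0 1)) (hf : IsPoissonSolution g f)
    (hq : IsQuasiconformalOn K f (Metric.ball 0 1)) (hM : supRadialLength f = (M : ℝ≥0∞))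
    {a b : ℕ → ℂ} (hab : HasHarmonicExpansion (poissonIntegral f) a b) {n : ℕ} (hn : 1 ≤ n) :
    ‖a n‖ + ‖b n‖ ≤ K * M + 2 / 3 * supNorm g := by
  obtain ⟨h1, h2⟩ := hab.unique (hasHarmonicExpansion_poissonIntegral hf.continuousOn) hn
  have hp : ‖(2 * Real.pi : ℂ)‖ = 2 * Real.pi := by simp [abs_of_pos Real.pi_pos]
  have hg0 : 0 ≤ supNorm g := (norm_nonneg _).trans (le_supNorm hg (z := 0) (by simp))
  have := norm_circleFourier_one_add_le hg hf hq hM hn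
  rw [h1, h2, RCLike.norm_conj, norm_div, norm_div, hp, ← add_div, div_le_iff₀ Real.two_pi_pos]
  -- Division by `2π` leaves `1/2` in front of `supNorm g`; its nonnegativity allows the weakening
  -- to `2/3`.
  nlinarith [mul_nonneg Real.pi_pos.le hg0]

/-! ### Sharpness: the map `z ↦ M z`. -/

section Linear

variable (M : ℝ)

lemma fderiv_ofReal_mul (z v : ℂ) : fderiv ℝ (fun z : ℂ => (M : ℂ) * z) z v = M * v := by
  have : HasFDerivAt (fun z : ℂ => (M : ℂ) * z) ((M : ℂ) • ContinuousLinearMap.id ℝ ℂ) z :=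
    (hasFDerivAt_id (𝕜 := ℝ) z).const_mul (M : ℂ)
  rw [this.fderiv]
  simp

lemma dz_ofReal_mul (z : ℂ) : dz (fun z : ℂ => (M : ℂ) * z) z = M := by
  rw [dz, fderiv_ofReal_mul, fderiv_ofReal_mul]
  linear_combination (-(M : ℂ) / 2) * I_mul_I

lemma dzbar_ofReal_mul (z : ℂ) : dzbar (fun z : ℂ => (M : ℂ) * z) z = 0 := by
  rw [dzbar, fderiv_ofReal_mul, fderiv_ofReal_mul]
  linear_combination ((M : ℂ) / 2) * I_mul_I

lemma isPoissonSolution_ofReal_mul : IsPoissonSolution 0 (fun z : ℂ => (M : ℂ) * z) where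
  continuousOn := by fun_prop
  contDiffOn := by fun_prop
  laplacian_eq z _ := by
    have : fderiv ℝ (fun z : ℂ => (M : ℂ) * z) =
        fun _ => (M : ℂ) • ContinuousLinearMap.id ℝ ℂ := by
      funext z; ext1; simp [fderiv_ofReal_mul]
    rw [laplacian_eq_fderiv_fderiv, this]
    simp

lemma isQuasiconformalOn_ofReal_mul (hM : 0 < M) :
    IsQuasiconformalOn 1 (fun z : ℂ => (M : ℂ) * z) (Metric.ball 0 1) where
  one_le := le_rfl
  contDiffOn := by fun_prop
  isOpenEmbedding := (Homeomorph.mulLeft₀ (M : ℂ) (ofReal_ne_zero.2 hM.ne')).isOpenEmbedding.comp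
    Metric.isOpen_ball.isOpenEmbedding_subtypeVal
  sensePreserving z _ := by
    rw [det_fderiv_eq, dz_ofReal_mul, dzbar_ofReal_mul, norm_zero, zero_pow two_ne_zero, sub_zero]
    positivity
  distortion z _ := by
    have h : ‖fderiv ℝ (fun z : ℂ => (M : ℂ) * z) z‖ ≤ M :=
      ContinuousLinearMap.opNorm_le_bound _ hM.le fun v => by
        rw [fderiv_ofReal_mul, norm_mul, norm_real, Real.norm_of_nonneg hM.le]
    rw [det_fderiv_eq, dz_ofReal_mul, dzbar_ofReal_mul, norm_zero, zero_pow two_ne_zero, sub_zero,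
      norm_real, Real.norm_of_nonneg hM.le]
    have := pow_le_pow_left₀ (norm_nonneg _) h 2
    rw [abs_of_nonneg (by positivity)]
    linarith

lemma radialLength_ofReal_mul (hM : 0 ≤ M) (r θ : ℝ) :
    radialLength (fun z : ℂ => (M : ℂ) * z) r θ = r * M := by
  simp [radialLength, dz_ofReal_mul, dzbar_ofReal_mul, abs_of_nonneg hM]

lemma supRadialLength_ofReal_mul (hM : 0 ≤ M) :
    supRadialLength (fun z : ℂ => (M : ℂ) * z) = ENNReal.ofReal M := by
  have h : ∀ θ, radialLengthOne (fun z : ℂ => (M : ℂ) * z) θ = ENNReal.ofReal M := by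
    intro θ
    simp only [radialLengthOne, radialLength_ofReal_mul M hM]
    refine le_antisymm (iSup₂_le fun r hr => ENNReal.ofReal_le_ofReal
      (mul_le_of_le_one_left hM hr.2.le)) ?_
    -- The supremum over `r < 1` of `r M` is not attained when `M > 0`, so the lower bound is
    -- obtained as a limit `r → 1`.
    have := right_nhdsWithin_Ioo_neBot (zero_lt_one (α := ℝ))
    have hc : ContinuousWithinAt (fun r : ℝ => ENNReal.ofReal (r * M)) (Ioo 0 1) 1 :=
      (ENNReal.continuous_ofReal.comp (continuous_mul_const M)).continuousWithinAt
    have := hc.tendsto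
    rw [one_mul] at this
    refine le_of_tendsto this ?_
    filter_upwards [self_mem_nhdsWithin] with r hr
    exact le_iSup₂ (f := fun r (_ : r ∈ Ico (0 : ℝ) 1) => ENNReal.ofReal (r * M)) r ⟨hr.1.le, hr.2⟩
  simp only [supRadialLength, h]
  exact biSup_const ⟨0, le_rfl, Real.two_pi_pos.le⟩

lemma circleFourier_ofReal_mul_one (k : ℤ) :
    circleFourier (fun z : ℂ => (M : ℂ) * z) k 1 =
      if k = 1 then (2 * Real.pi * M : ℂ) else 0 := by
  have : ∀ t : ℝ, (M : ℂ) * (((1 : ℝ) : ℂ) * exp (t * I)) * exp (-(k * t * I)) =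
      M * exp (((1 - k : ℤ) : ℂ) * t * I) := fun t => by
    rw [ofReal_one, one_mul, mul_assoc, ← exp_add]
    congr 2
    push_cast; ring
  simp only [circleFourier, this]
  rw [intervalIntegral.integral_const_mul, integral_exp_int_mul]
  simp only [sub_eq_zero, eq_comm (a := (1 : ℤ))]
  split_ifs <;> ring

lemma norm_coeff_one_ofReal_mul (hM : 0 ≤ M) {a b : ℕ → ℂ}
    (hab : HasHarmonicExpansion (poissonIntegral fun z : ℂ => (M : ℂ) * z) a b) :
    ‖a 1‖ + ‖b 1‖ = M := by
  obtain ⟨h1, h2⟩ := hab.unique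
    (hasHarmonicExpansion_poissonIntegral (isPoissonSolution_ofReal_mul M).continuousOn) le_rfl
  have hp : (2 * Real.pi : ℂ) ≠ 0 := by exact_mod_cast Real.two_pi_pos.ne'
  rw [h1, h2, circleFourier_ofReal_mul_one, circleFourier_ofReal_mul_one, if_pos (by simp),
    if_neg (by simp), mul_div_cancel_left₀ _ hp]
  simp [abs_of_nonneg hM]

end Linear

lemma supNorm_zero : supNorm 0 = 0 := by
  have : (Metric.closedBall (0 : ℂ) 1).Nonempty := ⟨0, by simp⟩
  simp [supNorm, this.image_const]

end PoissonQC

theorem theorem4 :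
    (∀ (g f : ℂ → ℂ) (K : ℝ) (M : ℝ≥0),
      ContinuousOn g (Metric.closedBall 0 1) →
      PoissonQC.IsPoissonSolution g f →
      PoissonQC.IsQuasiconformalOn K f (Metric.ball 0 1) →
      PoissonQC.supRadialLength f = (M : ℝ≥0∞) →
      (∃ a b : ℕ → ℂ,
        PoissonQC.HasHarmonicExpansion (PoissonQC.poissonIntegral f) a b) ∧
      ∀ a b : ℕ → ℂ,
        PoissonQC.HasHarmonicExpansion (PoissonQC.poissonIntegral f) a b →
        ∀ n : ℕ, 1 ≤ n →
          ‖a n‖ + ‖b n‖ ≤ K * (M : ℝ) + 2 / 3 * PoissonQC.supNorm g) ∧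
    (∀ (M : ℝ≥0) (f : ℂ → ℂ), 0 < M → (∀ z, f z = ((M : ℝ) : ℂ) * z) →
      PoissonQC.IsPoissonSolution 0 f ∧
      PoissonQC.IsQuasiconformalOn 1 f (Metric.ball 0 1) ∧
      PoissonQC.supRadialLength f = (M : ℝ≥0∞) ∧
      ∀ a b : ℕ → ℂ,
        PoissonQC.HasHarmonicExpansion (PoissonQC.poissonIntegral f) a b →
        ‖a 1‖ + ‖b 1‖ = 1 * (M : ℝ) + 2 / 3 * PoissonQC.supNorm 0) := by
  refine ⟨fun g f K M hg hf hq hM => ⟨⟨_, _,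
    PoissonQC.hasHarmonicExpansion_poissonIntegral hf.continuousOn⟩, fun a b hab n hn =>
    PoissonQC.norm_coeff_add_norm_coeff_le hg hf hq hM hab hn⟩, fun M f hM hf => ?_⟩
  obtain rfl : f = fun z : ℂ => ((M : ℝ) : ℂ) * z := funext hf
  refine ⟨PoissonQC.isPoissonSolution_ofReal_mul M, PoissonQC.isQuasiconformalOn_ofReal_mul M hM,
    ?_, fun a b hab => ?_⟩
  · rw [PoissonQC.supRadialLength_ofReal_mul M M.2, ENNReal.ofReal_coe_nnreal]
  · rw [PoissonQC.norm_coeff_one_ofReal_mul M M.2 hab, PoissonQC.supNorm_zero]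
    ring
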